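/- Let $k$ be an algebraically closed field, let $A$ and $B$ be finitely generated $\mathbb{N}$-graded $k$-algebras that are integral domains (the degree-$0$ parts are not required to be $k$), and let $I\subset A$ and $J\subset B$ be nonzero proper homogeneous ideals. Put $R=A\otimes_k B$, let $IR$ and $JR$ denote the extensions of $I$ and $J$ to $R$ along $a\mapsto a\otimes 1$ and $b\mapsto 1\otimes b$, and write $I+J$ for $IR+JR$. For an ideal $K$ of a Noetherian ring $S$ let $$K^{(m)}=\bigcap_{\mathfrak p\in \operatorname{Ass}(S/K)}\bigl(K^mS_{\mathfrak p}\cap S\bigr)$$ be the $m$-th symbolic power of $K$ (where $K^mS_{\mathfrak p}\cap S$ is the preimage of $K^mS_{\mathfrak p}$ in $S$), let $\overline{K}$ be the integral closure of $K$, that is, the set of all $x\in S$ that satisfy an equation $x^n+c_1x^{n-1}+\dots+c_n=0$ with $n\ge 1$ and $c_i\in K^i$, and define, as suprema in $[0,\infty]$ over integers $m,r\ge 1$, $$\rho_a(K)=\sup\Bigl\{\tfrac mr \;\Big|\; K^{(mt)}\not\subseteq K^{rt}\text{ for all } t\gg 0\Bigr\},$$ $$\overline\rho(K)=\sup\Bigl\{\tfrac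 mr \;\Big|\; K^{(m)}\not\subseteq \overline{K^{r}}\Bigr\},\qquad \overline\rho_a(K)=\sup\Bigl\{\tfrac mr \;\Big|\; K^{(mt)}\not\subseteq \overline{K^{rt}}\text{ for all } t\gg 0\Bigr\}.$$ Then $$\rho_a(I+J)=\overline\rho_a(I+J)=\overline\rho(I+J)=\max\{\rho_a(I),\rho_a(J)\}=\max\{\rho_a(IR),\rho_a(JR)\}.$$ -/

import Mathlib

open scoped TensorProduct ENNReal

namespace Resurgence

section

variable {A : Type*} [CommRing A]

/-- The `m`-th symbolic power `I^(m) = ⋂_{p ∈ Ass(A/I)} (I^m A_p ∩ A)`. -/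
def symbolicPower (I : Ideal A) (m : ℕ) : Ideal A :=
  ⨅ (p : PrimeSpectrum A) (_ : p.asIdeal ∈ associatedPrimes A (A ⧸ I)),
    ((I ^ m).map (algebraMap A (Localization.AtPrime p.asIdeal))).comap
      (algebraMap A (Localization.AtPrime p.asIdeal))

/-- The integral closure of an ideal `I`: all `x` satisfying an equation
`x^n + c_1 x^(n-1) + ... + c_n = 0` with `n ≥ 1` and `c_i ∈ I^i`. -/
def integralClosure (I : Ideal A) : Set A :=
  {x | ∃ n : ℕ, 1 ≤ n ∧ ∃ c : ℕ → A, (∀ i, c i ∈ I ^ i) ∧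
    x ^ n + ∑ i ∈ Finset.Icc 1 n, c i * x ^ (n - i) = 0}

/-- The asymptotic resurgence `ρ_a(I)`, a supremum in `[0, ∞]`. -/
noncomputable def asymptoticResurgence (I : Ideal A) : ℝ≥0∞ :=
  sSup {q | ∃ m r : ℕ, 1 ≤ m ∧ 1 ≤ r ∧ q = (m : ℝ≥0∞) / (r : ℝ≥0∞) ∧
    ∀ᶠ t : ℕ in Filter.atTop, ¬ symbolicPower I (m * t) ≤ I ^ (r * t)}

/-- The integral counterpart of the resurgence, `ρ̄(I)`, a supremum in `[0, ∞]`. -/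
noncomputable def icResurgence (I : Ideal A) : ℝ≥0∞ :=
  sSup {q | ∃ m r : ℕ, 1 ≤ m ∧ 1 ≤ r ∧ q = (m : ℝ≥0∞) / (r : ℝ≥0∞) ∧
    ¬ (symbolicPower I m : Set A) ⊆ integralClosure (I ^ r)}

/-- The integral counterpart of the asymptotic resurgence, `ρ̄_a(I)`, a supremum in `[0, ∞]`. -/
noncomputable def icAsymptoticResurgence (I : Ideal A) : ℝ≥0∞ :=
  sSup {q | ∃ m r : ℕ, 1 ≤ m ∧ 1 ≤ r ∧ q = (m : ℝ≥0∞) / (r : ℝ≥0∞) ∧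
    ∀ᶠ t : ℕ in Filter.atTop,
      ¬ (symbolicPower I (m * t) : Set A) ⊆ integralClosure (I ^ (r * t))}

end

section

variable (k : Type*) {A B : Type*} [Field k] [CommRing A] [CommRing B] [Algebra k A] [Algebra k B]

/-- The extension `IR` of an ideal `I` of `A` to `R = A ⊗ B`. -/
def extendLeft (B : Type*) [CommRing B] [Algebra k B] (I : Ideal A) : Ideal (A ⊗[k] B) :=
  I.map (Algebra.TensorProduct.includeLeft : A →ₐ[k] A ⊗[k] B)

/-- The extension `JR` of an ideal `J` of `B` to `R = A ⊗ B`. -/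
def extendRight (A : Type*) [CommRing A] [Algebra k A] (J : Ideal B) : Ideal (A ⊗[k] B) :=
  J.map (Algebra.TensorProduct.includeRight : B →ₐ[k] A ⊗[k] B)

end

end Resurgence

/-! For a nonzero ideal `K` of a finitely generated domain over a perfect field, the integral
closure of the Rees algebra of `K` in `S[X]` is a finite module. A degree bound `c` on its
generators shows that the integral closure of `K^n` lies in `K^(n-c)` for all `n`
(`exists_integralClosure_pow_subset`). A bounded loss is invisible asymptotically, so the three
resurgences of `K` coincide, and only the non-asymptotic integral one of `I + J` has to be compared
with those of `I` and `J`.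

Lower bound: a `k`-point of `V(J)` gives a retraction of `A ⊗ B` onto `A` that carries `I + J` to
`I`, and ring maps preserve integral equations. Upper bound: `symbolicPower_extendSum_le` puts
`(I+J)^(n+1)`, a symbolic power, inside any ideal containing all products of the symbolic powers
`I^(i)` and `J^(n-i)`. Applied to a large power `f^N` this makes `f` integral, as all rounding
losses stay bounded in `N`.

The binomial containment rests on `pR + qR` being prime for primes `p`, `q`, which uses that `k` is
algebraically closed. It allows denominators modulo `I + J` to be replaced by pure tensors of
denominators modulo `I` and `J`. -/

namespace Resurgence

/-! ### Finiteness of integral closure over a perfect field. -/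

section Finiteness

/-- Each `x` is a root of `X^(p^n) - x`, and finite type holds because Frobenius is onto on the
constants. -/
theorem finite_iterateFrobenius_mvPolynomial (k : Type*) [Field k] (p : ℕ) [ExpChar k p]
    [PerfectRing k p] (s n : ℕ) :
    (iterateFrobenius (MvPolynomial (Fin s) k) p n).Finite := by
  have hp : 0 < p ^ n := pow_pos (expChar_pos k p) n
  refine RingHom.IsIntegral.to_finite ?_ ?_
  · intro x
    refine ⟨Polynomial.X ^ (p ^ n) - Polynomial.C x,
      Polynomial.monic_X_pow_sub_C x hp.ne', ?_⟩
    simp [iterateFrobenius_def]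
  · have h1 : (iterateFrobenius (MvPolynomial (Fin s) k) p n).comp
        (MvPolynomial.C : k →+* MvPolynomial (Fin s) k) =
        (MvPolynomial.C : k →+* MvPolynomial (Fin s) k).comp (iterateFrobenius k p n) := by
      ext x
      simp [iterateFrobenius_def]
    have h2 : ((MvPolynomial.C : k →+* MvPolynomial (Fin s) k).comp
        (iterateFrobenius k p n)).FiniteType := by
      refine RingHom.FiniteType.comp ?_ (RingHom.FiniteType.of_surjective _
        (bijective_iterateFrobenius k p n).2)
      have : Algebra.FiniteType k (MvPolynomial (Fin s) k) := inferInstance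
      rwa [← RingHom.finiteType_algebraMap] at this
    rw [← h1] at h2
    exact RingHom.FiniteType.of_comp_finiteType h2

theorem finite_of_injective_ringHom {P C D : Type*} [CommRing P] [IsNoetherianRing P] [CommRing C]
    [Algebra P C] [CommRing D] (ψ : C →+* D) (hψ : Function.Injective ψ) (g : P →+* D)
    (hg : g.Finite) (hcomp : ∀ x, ψ (algebraMap P C x) = g x) : Module.Finite P C := by
  algebraize [g]
  exact Module.Finite.of_injective ({ ψ with commutes' := hcomp } : C →ₐ[P] D).toLinearMap hψ

/-- Over the separable closure `E` of `F` in `L` the classical finiteness theorem applies. The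
remaining step is purely inseparable: `x ↦ x^(p^n)` embeds the integral closure in `L` into the one
in `E`, semilinearly over the Frobenius of `P`, which is finite. -/
theorem finite_integralClosure_of_finite_iterateFrobenius {P F L : Type*} [CommRing P] [IsDomain P]
    [IsNoetherianRing P] [IsIntegrallyClosed P] [Field F] [Algebra P F] [IsFractionRing P F]
    [Field L] [Algebra F L] [Algebra P L] [IsScalarTower P F L] [FiniteDimensional F L]
    (p : ℕ) [ExpChar P p] [ExpChar F p] (hP : ∀ n, (iterateFrobenius P p n).Finite) :
    Module.Finite P (_root_.integralClosure P L) := by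
  let E := separableClosure F L
  have : FiniteDimensional E L := FiniteDimensional.right F E L
  have : ExpChar E p := expChar_of_injective_algebraMap (algebraMap F E).injective p
  have : ExpChar L p := expChar_of_injective_algebraMap (algebraMap F L).injective p
  have : IsScalarTower P E L := by
    refine .of_algebraMap_eq fun x => ?_
    rw [IsScalarTower.algebraMap_apply P F L, IsScalarTower.algebraMap_apply F E L,
      IsScalarTower.algebraMap_apply P F E]
  have hfin : Module.Finite P (_root_.integralClosure P E) :=
    IsIntegralClosure.finite P F E (_root_.integralClosure P E)
  let n := IsPurelyInseparable.exponent E L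
  let φ : L →+* E := IsPurelyInseparable.iterateFrobenius E L p (le_refl n)
  have hφ (x : L) : algebraMap E L (φ x) = x ^ p ^ n :=
    IsPurelyInseparable.algebraMap_iterateFrobenius E p (le_refl n) x
  have hint (x : _root_.integralClosure P L) : IsIntegral P (φ x) := by
    rw [← isIntegral_algebraMap_iff (algebraMap E L).injective, hφ]
    exact x.2.pow _
  let ψ : _root_.integralClosure P L →+* _root_.integralClosure P E :=
    (φ.comp (_root_.integralClosure P L).val.toRingHom).codRestrict (_root_.integralClosure P E) hint
  have hψ : Function.Injective ψ := fun x y h => by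
    have : φ x = φ y := congrArg Subtype.val h
    exact Subtype.ext (φ.injective this)
  let g : P →+* _root_.integralClosure P E :=
    (algebraMap P (_root_.integralClosure P E)).comp (iterateFrobenius P p n)
  have hg : g.Finite := by
    refine RingHom.Finite.comp ?_ (hP n)
    rwa [RingHom.finite_algebraMap]
  have hcomp (x : P) : ψ (algebraMap P _ x) = g x := by
    apply Subtype.ext
    apply (algebraMap E L).injective
    change algebraMap E L (φ (algebraMap P L x)) = algebraMap E L (algebraMap P E _)
    rw [hφ, ← IsScalarTower.algebraMap_apply, iterateFrobenius_def, map_pow]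
  exact finite_of_injective_ringHom ψ hψ g hg hcomp

/-- Noether normalization reduces to a polynomial ring `P`: by transitivity, elements of `L`
integral over `D` are integral over `P`. -/
theorem finite_integralClosure_fractionRing (k D L : Type*) [Field k] [PerfectField k]
    [CommRing D] [IsDomain D]
    [Algebra k D] [Algebra.FiniteType k D] [Field L] [Algebra D L] [IsFractionRing D L] :
    Module.Finite D (_root_.integralClosure D L) := by
  obtain ⟨s, g, hg, hfin⟩ := exists_finite_inj_algHom_of_fg k D
  let P := MvPolynomial (Fin s) k
  algebraize [g.toRingHom, (algebraMap D L).comp g.toRingHom]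
  have : Module.Finite P D := hfin
  have : FaithfulSMul P D := (faithfulSMul_iff_algebraMap_injective P D).2 hg
  have : IsScalarTower P D L := .of_algebraMap_eq fun _ => rfl
  have hPL : Function.Injective (algebraMap P L) := (IsFractionRing.injective D L).comp hg
  have : FaithfulSMul P L := (faithfulSMul_iff_algebraMap_injective P L).2 hPL
  let F := FractionRing P
  let : Algebra F L := FractionRing.liftAlgebra P L
  have : IsScalarTower P F L := FractionRing.isScalarTower_liftAlgebra P L
  have : Algebra.IsIntegral P D := inferInstance
  have : FiniteDimensional F L := .of_isLocalization P D (nonZeroDivisors P)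
  obtain ⟨p, hp⟩ := ExpChar.exists k
  have : PerfectRing k p := PerfectField.toPerfectRing p
  have : ExpChar P p := expChar_of_injective_algebraMap (algebraMap k P).injective p
  have : ExpChar F p := expChar_of_injective_algebraMap (IsFractionRing.injective P F) p
  have := finite_integralClosure_of_finite_iterateFrobenius (P := P) (F := F) (L := L) p
    (finite_iterateFrobenius_mvPolynomial k p s)
  have h2 : Module.Finite P ((_root_.integralClosure D L).restrictScalars P) := by
    refine Module.Finite.of_injective (N := _root_.integralClosure P L) (LinearMap.codRestrict
      (Subalgebra.toSubmodule (_root_.integralClosure P L))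
      (((_root_.integralClosure D L).restrictScalars P).val.toLinearMap) ?_) ?_
    · intro x
      exact isIntegral_trans (R := P) (A := D) x.1 x.2
    · intro x y h
      exact Subtype.ext (congrArg (fun z : _root_.integralClosure P L => (z : L)) h)
  have h3 : Module.Finite P (_root_.integralClosure D L) := h2
  exact Module.Finite.of_restrictScalars_finite P D (_root_.integralClosure D L)

end Finiteness
-- Rees algebras, and the uniform bound on integral closures of powers.
section ReesAlgebra

open Polynomial

/-- Multiplying numerator and denominator by a high power of a nonzero `a ∈ K` moves both into the
Rees algebra. -/
theorem isFractionRing_reesAlgebra {S L : Type*} [CommRing S] [IsDomain S] {K : Ideal S}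
    (hK : K ≠ ⊥) [Field L] [Algebra S[X] L] [IsFractionRing S[X] L] :
    IsFractionRing (reesAlgebra K) L := by
  obtain ⟨a, haK, ha⟩ := Submodule.exists_mem_ne_zero_of_ne_bot hK
  have hmem (f : S[X]) : ∃ d, ∀ e, d ≤ e → C (a ^ e) * f ∈ reesAlgebra K := by
    refine ⟨f.natDegree, fun e he i => ?_⟩
    rw [coeff_C_mul]
    by_cases hi : i ≤ f.natDegree
    · exact Ideal.mul_mem_right _ _ (Ideal.pow_le_pow_right (hi.trans he) (Ideal.pow_mem_pow haK e))
    · simp [coeff_eq_zero_of_natDegree_lt (not_le.1 hi)]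
  have hinj : Function.Injective (algebraMap S[X] L) := IsFractionRing.injective S[X] L
  have : FaithfulSMul (reesAlgebra K) L := by
    rw [faithfulSMul_iff_algebraMap_injective]
    exact hinj.comp Subtype.val_injective
  refine IsFractionRing.of_field _ _ fun z => ?_
  obtain ⟨x, y, hy, rfl⟩ := IsFractionRing.div_surjective (A := S[X]) z
  obtain ⟨d, hd⟩ := hmem x
  obtain ⟨d', hd'⟩ := hmem y
  refine ⟨⟨_, hd (max d d') (le_max_left _ _)⟩, ⟨_, hd' (max d d') (le_max_right _ _)⟩, ?_⟩
  change _ = algebraMap S[X] L (C _ * x) / algebraMap S[X] L (C _ * y)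
  rw [map_mul, map_mul, mul_div_mul_left]
  rw [Ne, map_eq_zero_iff _ hinj, C_eq_zero]
  exact pow_ne_zero _ ha

/-- Multiply the integral equation of `x`, of degree `N`, by `X^(n * N)`. -/
theorem isIntegral_monomial_of_mem_integralClosure {S : Type*} [CommRing S] {K : Ideal S} {n : ℕ}
    {x : S} (hx : x ∈ integralClosure (K ^ n)) : IsIntegral (reesAlgebra K) (monomial n x) := by
  obtain ⟨N, hN, c, hc, h⟩ := hx
  have hmem (i : ℕ) : monomial (n * i) (c i) ∈ reesAlgebra K := by
    rw [reesAlgebra.monomial_mem, pow_mul]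
    exact hc i
  nontriviality S
  refine ⟨X ^ N + ∑ i ∈ Finset.Icc 1 N, C (⟨_, hmem i⟩ : reesAlgebra K) * X ^ (N - i),
    monic_X_pow_add ?_, ?_⟩
  · refine (degree_sum_le _ _).trans_lt ?_
    rw [Finset.sup_lt_iff (by simp)]
    intro i hi
    refine (degree_C_mul_X_pow_le _ _).trans_lt ?_
    rw [Finset.mem_Icc] at hi
    exact_mod_cast (by omega : N - i < N)
  · simp only [eval₂_add, eval₂_pow, eval₂_X, eval₂_finsetSum, eval₂_mul, eval₂_C]
    have hterm : ∀ i ∈ Finset.Icc 1 N, algebraMap (reesAlgebra K) S[X] ⟨_, hmem i⟩ *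
        (monomial n x) ^ (N - i) = monomial (n * N) (c i * x ^ (N - i)) := by
      intro i hi
      rw [Finset.mem_Icc] at hi
      change monomial (n * i) (c i) * _ = _
      rw [monomial_pow, monomial_mul_monomial, ← Nat.mul_add]
      congr 3
      omega
    rw [Finset.sum_congr rfl hterm, ← map_sum, monomial_pow, ← map_add, h, map_zero]

theorem finite_integralClosure_of_injective {D E L : Type*} [CommRing D] [IsNoetherianRing D]
    [CommRing E] [CommRing L] [Algebra D E] [Algebra E L] [Algebra D L] [IsScalarTower D E L]
    [Module.Finite D (_root_.integralClosure D L)] (h : Function.Injective (algebraMap E L)) :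
    Module.Finite D (_root_.integralClosure D E) := by
  let f : _root_.integralClosure D E →ₐ[D] _root_.integralClosure D L :=
    (IsScalarTower.toAlgHom D E L).mapIntegralClosure
  exact Module.Finite.of_injective f.toLinearMap fun x y hxy =>
    Subtype.ext (h (congrArg Subtype.val hxy))

theorem exists_integralClosure_pow_subset (k : Type*) {S : Type*} [Field k] [PerfectField k]
    [CommRing S] [IsDomain S] [Algebra k S] [Algebra.FiniteType k S] {K : Ideal S} (hK : K ≠ ⊥) :
    ∃ c : ℕ, ∀ n, integralClosure (K ^ n) ⊆ (K ^ (n - c) : Ideal S) := by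
  have : IsNoetherianRing S := Algebra.FiniteType.isNoetherianRing k S
  let L := FractionRing S[X]
  have := isFractionRing_reesAlgebra (L := L) hK
  have : Algebra.FiniteType k (reesAlgebra K) := Algebra.FiniteType.trans (S := S) ‹_› inferInstance
  have := finite_integralClosure_fractionRing k (reesAlgebra K) L
  let C := _root_.integralClosure (reesAlgebra K) S[X]
  have : Module.Finite (reesAlgebra K) C := by
    exact finite_integralClosure_of_injective (L := L) (IsFractionRing.injective S[X] L)
  obtain ⟨T, hT⟩ := Module.Finite.fg_top (R := reesAlgebra K) (M := C)
  -- Beyond degree `c` the generators have no coefficients, and up to `c` the truncated `n - c`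
  -- makes the condition empty. Multiplying by an element of the Rees algebra preserves the bound.
  let c := T.sup fun z => (z : S[X]).natDegree
  have key (z : C) : ∀ n, (z : S[X]).coeff n ∈ K ^ (n - c) := by
    have hz : z ∈ Submodule.span (reesAlgebra K) (T : Set C) := hT ▸ Submodule.mem_top
    induction hz using Submodule.span_induction with
    | mem z hz =>
      intro n
      by_cases hn : n ≤ c
      · simp [Nat.sub_eq_zero_of_le hn]
      · have : (z : S[X]).natDegree ≤ c := Finset.le_sup (f := fun z : C => (z : S[X]).natDegree) hz
        rw [coeff_eq_zero_of_natDegree_lt (by omega)]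
        exact Ideal.zero_mem _
    | zero => intro n; exact Ideal.zero_mem _
    | add x y _ _ hx hy =>
      intro n
      change ((x : S[X]) + (y : S[X])).coeff n ∈ _
      rw [coeff_add]
      exact Ideal.add_mem _ (hx n) (hy n)
    | smul a x _ hx =>
      intro n
      change ((a : S[X]) * (x : S[X])).coeff n ∈ _
      rw [coeff_mul]
      refine Ideal.sum_mem _ fun ij hij => ?_
      rw [Finset.HasAntidiagonal.mem_antidiagonal] at hij
      have := Ideal.mul_mem_mul (a.2 ij.1) (hx ij.2)
      rw [← pow_add] at this
      exact Ideal.pow_le_pow_right (by omega) this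
  refine ⟨c, fun n x hx => ?_⟩
  simpa using key ⟨monomial n x, isIntegral_monomial_of_mem_integralClosure hx⟩ n

end ReesAlgebra
-- Comparing and interpolating fractions in `[0, ∞]`.
section Arithmetic

theorem natCast_div_lt_natCast_div_iff {m r m' r' : ℕ} (hr : 1 ≤ r) (hr' : 1 ≤ r') :
    (m : ℝ≥0∞) / r < (m' : ℝ≥0∞) / r' ↔ m * r' < m' * r := by
  have h1 : (r : NNReal) ≠ 0 := by positivity
  have h2 : (r' : NNReal) ≠ 0 := by positivity
  have h (a b : ℕ) (hb : (b : NNReal) ≠ 0) :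
      (a : ℝ≥0∞) / b = ((a / b : NNReal) : ℝ≥0∞) := by
    rw [ENNReal.coe_div hb]; simp
  rw [h _ _ h1, h _ _ h2, ENNReal.coe_lt_coe,
    div_lt_div_iff₀ (pos_iff_ne_zero.2 h1) (pos_iff_ne_zero.2 h2)]
  exact_mod_cast Iff.rfl

theorem exists_natCast_div_between {a b : ℝ≥0∞} (h : a < b) :
    ∃ p q : ℕ, 1 ≤ p ∧ 1 ≤ q ∧ a < (p : ℝ≥0∞) / q ∧ (p : ℝ≥0∞) / q < b := by
  obtain ⟨x, hx0, hax, hxb⟩ := ENNReal.lt_iff_exists_rat_btwn.1 h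
  have hx : Real.toNNReal x = (x.num.toNat : NNReal) / x.den := by
    have h1 : ((x.num.toNat : ℕ) : ℝ) = ((x.num : ℤ) : ℝ) := by
      exact_mod_cast Int.toNat_of_nonneg (Rat.num_nonneg.2 hx0)
    apply NNReal.coe_injective
    rw [Real.coe_toNNReal _ (by exact_mod_cast hx0)]
    push_cast
    rw [h1]
    exact_mod_cast (Rat.num_div_den x).symm
  have hd : (x.den : NNReal) ≠ 0 := by exact_mod_cast x.den_nz
  have hx' : ((Real.toNNReal x : NNReal) : ℝ≥0∞) = (x.num.toNat : ℝ≥0∞) / (x.den : ℝ≥0∞) := by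
    rw [hx, ENNReal.coe_div hd]; simp
  rw [hx'] at hax hxb
  refine ⟨x.num.toNat, x.den, ?_, x.den_pos, hax, hxb⟩
  by_contra h0
  have : x.num.toNat = 0 := by omega
  rw [this] at hax
  simp at hax

end Arithmetic

/-! ### Symbolic powers through denominators. -/

section SymbolicPower

variable {A : Type*} [CommRing A]

/-- `s` is a nonzerodivisor modulo `I`. -/
def RegularMod (I : Ideal A) (s : A) : Prop := ∀ y, s * y ∈ I → y ∈ I

theorem RegularMod.one (I : Ideal A) : RegularMod I 1 := fun y hy => by simpa using hy

theorem RegularMod.mul {I : Ideal A} {s t : A} (hs : RegularMod I s) (ht : RegularMod I t) :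
    RegularMod I (s * t) := fun y hy => ht y (hs _ (by rwa [← mul_assoc]))

theorem RegularMod.pow {I : Ideal A} {s : A} (hs : RegularMod I s) (n : ℕ) :
    RegularMod I (s ^ n) := by
  induction n with
  | zero => simpa using RegularMod.one I
  | succ n ih => rw [pow_succ]; exact ih.mul hs

theorem regularMod_iff_forall_associatedPrimes [IsNoetherianRing A] {I : Ideal A} {s : A} :
    RegularMod I s ↔ ∀ p ∈ associatedPrimes A (A ⧸ I), s ∉ p := by
  have h := biUnion_associatedPrimes_eq_zero_divisors A (A ⧸ I)
  have h2 : (∀ p ∈ associatedPrimes A (A ⧸ I), s ∉ p) ↔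
      s ∉ ⋃ p ∈ associatedPrimes A (A ⧸ I), (p : Set A) := by simp
  rw [h2, h]
  simp only [Set.mem_ofPred_eq, not_exists, not_and]
  constructor
  · intro hs x hx hsx
    obtain ⟨y, rfl⟩ := Ideal.Quotient.mk_surjective x
    rw [Algebra.smul_def, Ideal.Quotient.algebraMap_eq, ← map_mul,
      Ideal.Quotient.eq_zero_iff_mem] at hsx
    exact hx (Ideal.Quotient.eq_zero_iff_mem.2 (hs y hsx))
  · intro hs y hy
    by_contra hy'
    refine hs (Ideal.Quotient.mk I y) (mt Ideal.Quotient.eq_zero_iff_mem.1 hy') ?_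
    rw [Algebra.smul_def, Ideal.Quotient.algebraMap_eq, ← map_mul]
    exact Ideal.Quotient.eq_zero_iff_mem.2 hy

/-- An ideal all of whose elements are zerodivisors modulo `I` lies in an associated prime. -/
theorem exists_le_associatedPrime [IsNoetherianRing A] {I a : Ideal A}
    (h : ∀ s ∈ a, ¬ RegularMod I s) : ∃ p ∈ associatedPrimes A (A ⧸ I), a ≤ p := by
  refine (a.subset_union_prime_finite (associatedPrimes.finite A (A ⧸ I)) (f := id) 0 0
    fun _ h _ _ ↦ h.isPrime).1 fun s hs => ?_
  have := h s hs
  rw [regularMod_iff_forall_associatedPrimes] at this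
  push Not at this
  simpa using this

/-- One global denominator replaces the local ones. If the colon ideal of `I^m` by `x` had no
element regular modulo `I`, prime avoidance would put it in an associated prime, against membership
in that localization. -/
theorem mem_symbolicPower_iff [IsNoetherianRing A] {I : Ideal A} {m : ℕ} {x : A} :
    x ∈ symbolicPower I m ↔ ∃ s, RegularMod I s ∧ s * x ∈ I ^ m := by
  have hloc (p : PrimeSpectrum A) : x ∈ ((I ^ m).map (algebraMap A (Localization.AtPrime
      p.asIdeal))).comap (algebraMap A (Localization.AtPrime p.asIdeal)) ↔
      ∃ s ∉ p.asIdeal, s * x ∈ I ^ m := by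
    rw [Ideal.mem_comap, IsLocalization.algebraMap_mem_map_algebraMap_iff p.asIdeal.primeCompl]
    rfl
  simp only [symbolicPower, Ideal.mem_iInf, hloc]
  constructor
  · intro h
    by_contra hcon
    push Not at hcon
    obtain ⟨p, hp, hle⟩ := exists_le_associatedPrime (I := I)
      (a := (I ^ m).colon {x}) fun s hs hreg => hcon s hreg (by
        simpa [Submodule.mem_colon_singleton] using hs)
    obtain ⟨s, hs, hsx⟩ := h ⟨p, hp.isPrime⟩ hp
    exact hs (hle (by simpa [Submodule.mem_colon_singleton] using hsx))
  · rintro ⟨s, hs, hsx⟩ p hp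
    exact ⟨s, regularMod_iff_forall_associatedPrimes.1 hs _ hp, hsx⟩

theorem pow_le_symbolicPower [IsNoetherianRing A] (I : Ideal A) (m : ℕ) :
    I ^ m ≤ symbolicPower I m := fun x hx =>
  mem_symbolicPower_iff.2 ⟨1, RegularMod.one I, by simpa using hx⟩

theorem symbolicPower_antitone [IsNoetherianRing A] (I : Ideal A) :
    Antitone (symbolicPower I) := fun m n hmn x hx => by
  rw [mem_symbolicPower_iff] at hx ⊢
  obtain ⟨s, hs, hsx⟩ := hx
  exact ⟨s, hs, Ideal.pow_le_pow_right hmn hsx⟩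

theorem symbolicPower_zero [IsNoetherianRing A] (I : Ideal A) : symbolicPower I 0 = ⊤ :=
  top_le_iff.1 ((by simp : (⊤ : Ideal A) ≤ I ^ 0).trans (pow_le_symbolicPower I 0))

theorem pow_mem_symbolicPower [IsNoetherianRing A] {I : Ideal A} {m : ℕ} {x : A}
    (hx : x ∈ symbolicPower I m) (n : ℕ) : x ^ n ∈ symbolicPower I (m * n) := by
  rw [mem_symbolicPower_iff] at hx ⊢
  obtain ⟨s, hs, hsx⟩ := hx
  refine ⟨s ^ n, hs.pow n, ?_⟩
  rw [← mul_pow, pow_mul]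
  exact Ideal.pow_mem_pow hsx n

theorem RegularMod.symbolicPower [IsNoetherianRing A] {I : Ideal A} {s : A} (hs : RegularMod I s)
    (m : ℕ) : RegularMod (symbolicPower I m) s := fun y hy => by
  rw [mem_symbolicPower_iff] at hy ⊢
  obtain ⟨t, ht, h⟩ := hy
  exact ⟨t * s, ht.mul hs, by rwa [mul_assoc]⟩

end SymbolicPower

/-! ### Integral closure of ideals. -/

section IntegralClosure

variable {A : Type*} [CommRing A]

theorem mem_integralClosure_of_pow_mem {K : Ideal A} {r n : ℕ} (hn : 1 ≤ n) {f : A}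
    (hf : f ^ n ∈ K ^ (r * n)) : f ∈ integralClosure (K ^ r) := by
  classical
  refine ⟨n, hn, fun i => if i = n then -f ^ n else 0, fun i => ?_, ?_⟩
  · dsimp only
    split_ifs with h
    · rw [h, ← pow_mul]; exact neg_mem hf
    · exact Ideal.zero_mem _
  · rw [Finset.sum_eq_single n]
    · simp
    · intro b _ hb; simp [hb]
    · intro h; simp [hn] at h

theorem map_mem_integralClosure {B : Type*} [CommRing B] (φ : A →+* B) {K : Ideal A} {K' : Ideal B}
    (h : K.map φ ≤ K') {x : A} (hx : x ∈ integralClosure K) : φ x ∈ integralClosure K' := by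
  obtain ⟨n, hn, c, hc, e⟩ := hx
  refine ⟨n, hn, fun i => φ (c i), fun i => ?_, ?_⟩
  · refine Ideal.pow_right_mono h i ?_
    rw [← Ideal.map_pow]
    exact Ideal.mem_map_of_mem φ (hc i)
  · simpa using congrArg φ e

end IntegralClosure

/-! ### Equality of the three resurgences, given the uniform bound. -/

section Comparison

variable {A : Type*} [CommRing A]

theorem icAsymptoticResurgence_le_icResurgence (K : Ideal A) :
    icAsymptoticResurgence K ≤ icResurgence K := by
  refine sSup_le ?_
  rintro q ⟨m, r, hm, hr, rfl, h⟩
  obtain ⟨t, ht, ht1⟩ := (h.and (Filter.eventually_ge_atTop 1)).exists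
  refine le_sSup ⟨m * t, r * t, Nat.mul_pos hm ht1, Nat.mul_pos hr ht1, ?_, ht⟩
  push_cast
  rw [ENNReal.mul_div_mul_right _ _ (by positivity) (by simp)]

theorem frequently_symbolicPower_le {K : Ideal A} {m r : ℕ} (hm : 1 ≤ m) (hr : 1 ≤ r)
    (h : asymptoticResurgence K < (m : ℝ≥0∞) / r) :
    ∃ᶠ t : ℕ in Filter.atTop, symbolicPower K (m * t) ≤ K ^ (r * t) := by
  by_contra hcon
  rw [Filter.not_frequently] at hcon
  exact h.not_ge (le_sSup ⟨m, r, hm, hr, rfl, hcon⟩)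

theorem symbolicPower_subset_of_icResurgence_lt {K : Ideal A} {m r : ℕ} (hm : 1 ≤ m) (hr : 1 ≤ r)
    (h : icResurgence K < (m : ℝ≥0∞) / r) :
    (symbolicPower K m : Set A) ⊆ integralClosure (K ^ r) := by
  by_contra hcon
  exact h.not_ge (le_sSup ⟨m, r, hm, hr, rfl, hcon⟩)

theorem icResurgence_le_asymptoticResurgence [IsNoetherianRing A] (K : Ideal A) :
    icResurgence K ≤ asymptoticResurgence K := by
  refine sSup_le ?_
  rintro q ⟨m', r', hm', hr', rfl, h⟩
  by_contra! hlt
  obtain ⟨m, r, hm, hr, h1, h2⟩ := exists_natCast_div_between hlt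
  rw [natCast_div_lt_natCast_div_iff hr hr'] at h2
  obtain ⟨t, ht, hle⟩ := (Filter.frequently_atTop.1 (frequently_symbolicPower_le hm hr h1))
    (m' * r' + 1)
  refine h fun f hf => ?_
  -- Rounding up gives `m * t ≤ m' * n`, so `f^n` lies in the symbolic power of order `m * t`, hence
  -- in `K^(r*t)`. The strict inequality `m * r' < m' * r` and `t > m' * r'` pay for the rounding
  -- and give `r' * n ≤ r * t`.
  let n := m * t / m' + 1
  have hn1 : m * t ≤ m' * n := by
    have := Nat.div_add_mod (m * t) m'
    have := Nat.mod_lt (m * t) hm'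
    simp only [n, mul_add]; omega
  have hn2 : m' * (r' * n) ≤ m' * (r * t) := by
    have := Nat.mul_div_le (m * t) m'
    have h3 : r' * (m' * (m * t / m')) ≤ r' * (m * t) := Nat.mul_le_mul_left _ this
    have h4 : (m * r' + 1) * t ≤ (m' * r) * t := Nat.mul_le_mul_right _ h2
    simp only [n]
    nlinarith
  refine mem_integralClosure_of_pow_mem (n := n) (by simp [n]) ?_
  exact Ideal.pow_le_pow_right (Nat.le_of_mul_le_mul_left hn2 hm')
    (hle (symbolicPower_antitone K hn1 (pow_mem_symbolicPower hf n)))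

theorem asymptoticResurgence_le_icAsymptoticResurgence [IsNoetherianRing A] {K : Ideal A} {c : ℕ}
    (hc : ∀ n, integralClosure (K ^ n) ⊆ (K ^ (n - c) : Ideal A)) :
    asymptoticResurgence K ≤ icAsymptoticResurgence K := by
  refine sSup_le ?_
  rintro q ⟨m, r, hm, hr, rfl, h⟩
  by_contra! hlt
  obtain ⟨m', r', hm', hr', h1, h2⟩ := exists_natCast_div_between hlt
  rw [natCast_div_lt_natCast_div_iff hr' hr] at h2
  have hfreq : ∃ᶠ t : ℕ in Filter.atTop,
      (symbolicPower K (m' * t) : Set A) ⊆ integralClosure (K ^ (r' * t)) := by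
    by_contra hcon
    rw [Filter.not_frequently] at hcon
    exact h1.not_ge (le_sSup ⟨m', r', hm', hr', rfl, hcon⟩)
  obtain ⟨T, hT⟩ := Filter.eventually_atTop.1 h
  -- The term `m * T` forces `u ≥ T` below; `m * (r + c)` pays for rounding `u` up and for the loss
  -- `c`.
  obtain ⟨t, ht, hle⟩ := Filter.frequently_atTop.1 hfreq (m * T + m * (r + c))
  let u := m' * t / m + 1
  have hu1 : m' * t ≤ m * u := by
    have := Nat.div_add_mod (m' * t) m
    have := Nat.mod_lt (m' * t) hm
    simp only [u, mul_add]; omega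
  have hmt : t ≤ m * u := (Nat.le_mul_of_pos_left t hm').trans hu1
  have huT : T ≤ u := Nat.le_of_mul_le_mul_left (by omega : m * T ≤ m * u) hm
  have hu2 : m * (r * u + c) ≤ m * (r' * t) := by
    have := Nat.mul_div_le (m' * t) m
    have h3 : r * (m * (m' * t / m)) ≤ r * (m' * t) := Nat.mul_le_mul_left _ this
    have h4 : (m' * r + 1) * t ≤ (m * r') * t := Nat.mul_le_mul_right _ h2
    simp only [u]
    nlinarith
  have hu3 := Nat.le_of_mul_le_mul_left hu2 hm
  refine hT u huT fun x hx => ?_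
  exact Ideal.pow_le_pow_right (by omega) (hc _ (hle (symbolicPower_antitone K hu1 hx)))

end Comparison
-- Rational points, and tensor products of domains.
section Points

variable (k : Type*) [Field k] [IsAlgClosed k]

theorem nonempty_algHom_of_isAlgClosed (C : Type*) [CommRing C] [Nontrivial C] [Algebra k C]
    [Algebra.FiniteType k C] : Nonempty (C →ₐ[k] k) := by
  obtain ⟨m, hm⟩ := Ideal.exists_maximal C
  let := Ideal.Quotient.field m
  have : Module.Finite k (C ⧸ m) := finite_of_finite_type_of_isJacobsonRing k (C ⧸ m)
  have hb : Function.Bijective (algebraMap k (C ⧸ m)) :=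
    IsAlgClosed.algebraMap_bijective_of_isIntegral
  exact ⟨((AlgEquiv.ofBijective (Algebra.ofId k (C ⧸ m)) hb).symm : (C ⧸ m) →ₐ[k] k).comp
    (Ideal.Quotient.mkₐ k m)⟩

theorem exists_algHom_apply_ne_zero {A : Type*} [CommRing A] [IsDomain A] [Algebra k A]
    [Algebra.FiniteType k A] {a : A} (ha : a ≠ 0) : ∃ ε : A →ₐ[k] k, ε a ≠ 0 := by
  let A' := Localization.Away a
  have : Nontrivial A' := (IsLocalization.injective A'
    (powers_le_nonZeroDivisors_of_noZeroDivisors ha)).nontrivial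
  have : Algebra.FiniteType A A' := IsLocalization.finiteType_of_monoid_fg (.powers a) A'
  have : Algebra.FiniteType k A' := Algebra.FiniteType.trans (S := A) ‹_› ‹_›
  obtain ⟨ε⟩ := nonempty_algHom_of_isAlgClosed k A'
  refine ⟨ε.comp (IsScalarTower.toAlgHom k A A'), ?_⟩
  exact ((IsLocalization.Away.algebraMap_isUnit (S := A') a).map ε).ne_zero

/-- A tensor product of two domains over an algebraically closed field is a domain. -/
theorem isDomain_tensorProduct (A B : Type*) [CommRing A] [IsDomain A] [Algebra k A]
    [Algebra.FiniteType k A] [CommRing B] [IsDomain B] [Algebra k B] : IsDomain (A ⊗[k] B) := by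
  let b := Module.Basis.ofVectorSpace k B
  let b' := Algebra.TensorProduct.basis A b
  -- Specialization at a `k`-point `ε` of `A` applies `ε` to coordinates in the basis `b`. For
  -- nonzero `x`, `y` with `x * y = 0`, a point where one coordinate of each survives contradicts
  -- that `B` is a domain.
  let ev (ε : A →ₐ[k] k) : A ⊗[k] B →ₐ[k] B :=
    Algebra.TensorProduct.lift ((Algebra.ofId k B).comp ε) (AlgHom.id k B) fun _ _ => .all _ _
  have hev (ε : A →ₐ[k] k) (x : A ⊗[k] B) (i) : b.repr (ev ε x) i = ε (b'.repr x i) := by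
    induction x with
    | zero => simp
    | add x y hx hy => simp [hx, hy]
    | tmul x y =>
      simp only [ev, b', Algebra.TensorProduct.lift_tmul, Algebra.TensorProduct.basis_repr_tmul]
      simp [Algebra.ofId_apply, ← Algebra.smul_def]
  have hne (x : A ⊗[k] B) (hx : x ≠ 0) : ∃ i, b'.repr x i ≠ 0 := by
    by_contra! h
    exact hx (b'.repr.map_eq_zero_iff.1 (Finsupp.ext h))
  have : NoZeroDivisors (A ⊗[k] B) := by
    refine ⟨fun {x y} hxy => ?_⟩
    by_contra! hcon
    obtain ⟨i, hi⟩ := hne x hcon.1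
    obtain ⟨j, hj⟩ := hne y hcon.2
    obtain ⟨ε, hε⟩ := exists_algHom_apply_ne_zero k (mul_ne_zero hi hj)
    rw [map_mul, ← hev, ← hev] at hε
    have h0 : ev ε x * ev ε y = 0 := by rw [← map_mul, hxy, map_zero]
    rcases mul_eq_zero.1 h0 with h | h <;> simp [h] at hε
  have : Nontrivial (A ⊗[k] B) := inferInstance
  exact NoZeroDivisors.to_isDomain _

end Points

/-! ### Extended ideals: colons, primes and regular elements. -/

section Extension

variable (k : Type*) {A B : Type*} [Field k] [CommRing A] [CommRing B] [Algebra k A] [Algebra k B]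

/-- The ideal `IR + JR` of `R = A ⊗ B`. -/
abbrev extendSum (I : Ideal A) (J : Ideal B) : Ideal (A ⊗[k] B) :=
  extendLeft k B I ⊔ extendRight k A J

theorem extendSum_eq_ker (I : Ideal A) (J : Ideal B) :
    extendSum k I J = RingHom.ker (Algebra.TensorProduct.map (Ideal.Quotient.mkₐ k I)
      (Ideal.Quotient.mkₐ k J)) := by
  rw [Algebra.TensorProduct.map_ker _ _ (Ideal.Quotient.mkₐ_surjective k I)
    (Ideal.Quotient.mkₐ_surjective k J)]
  have h1 : RingHom.ker (Ideal.Quotient.mkₐ k I) = I := Ideal.mk_ker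
  have h2 : RingHom.ker (Ideal.Quotient.mkₐ k J) = J := Ideal.mk_ker
  rw [h1, h2]
  rfl

theorem extendSum_mono {I I' : Ideal A} {J J' : Ideal B} (h : I ≤ I') (h' : J ≤ J') :
    extendSum k I J ≤ extendSum k I' J' :=
  sup_le_sup (Ideal.map_mono h) (Ideal.map_mono h')

theorem extendLeft_mono {I I' : Ideal A} (h : I ≤ I') : extendLeft k B I ≤ extendLeft k B I' :=
  Ideal.map_mono h

theorem extendRight_mono {J J' : Ideal B} (h : J ≤ J') : extendRight k A J ≤ extendRight k A J' :=
  Ideal.map_mono h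

theorem extendLeft_pow (I : Ideal A) (n : ℕ) :
    extendLeft k B (I ^ n) = extendLeft k B I ^ n := Ideal.map_pow _ _ _

theorem extendRight_pow (J : Ideal B) (n : ℕ) :
    extendRight k A (J ^ n) = extendRight k A J ^ n := Ideal.map_pow _ _ _

theorem tmul_one_mem_extendLeft {I : Ideal A} {x : A} (hx : x ∈ I) :
    x ⊗ₜ[k] (1 : B) ∈ extendLeft k B I := Ideal.mem_map_of_mem _ hx

theorem one_tmul_mem_extendRight {J : Ideal B} {y : B} (hy : y ∈ J) :
    (1 : A) ⊗ₜ[k] y ∈ extendRight k A J := Ideal.mem_map_of_mem _ hy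

/-- Colon ideals by elements of `A` commute with the extension to `A ⊗ B`. -/
theorem mem_extendSum_of_tmul_one_mul_mem {I I' : Ideal A} (J : Ideal B) {a : A}
    (h : ∀ x, a * x ∈ I ↔ x ∈ I') {z : A ⊗[k] B} (hz : a ⊗ₜ 1 * z ∈ extendSum k I J) :
    z ∈ extendSum k I' J := by
  rw [extendSum_eq_ker, RingHom.mem_ker] at hz ⊢
  -- Multiplication by `a` is injective from `A ⧸ I'` to `A ⧸ I`, and stays so after tensoring with
  -- `B ⧸ J`, which is flat over `k`.
  let f : A ⧸ I' →ₗ[A] A ⧸ I := Submodule.mapQ I' I (LinearMap.mulLeft A a) fun x hx => (h x).2 hx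
  have hf : Function.Injective f := by
    rw [injective_iff_map_eq_zero]
    intro x hx
    obtain ⟨x, rfl⟩ := Ideal.Quotient.mk_surjective x
    exact Ideal.Quotient.eq_zero_iff_mem.2 ((h x).1 (Ideal.Quotient.eq_zero_iff_mem.1 hx))
  have hcomm (z : A ⊗[k] B) : (f.restrictScalars k).rTensor (B ⧸ J)
      (Algebra.TensorProduct.map (Ideal.Quotient.mkₐ k I') (Ideal.Quotient.mkₐ k J) z) =
      Algebra.TensorProduct.map (Ideal.Quotient.mkₐ k I) (Ideal.Quotient.mkₐ k J)
        (a ⊗ₜ 1 * z) := by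
    induction z with
    | zero => simp
    | add x y hx hy => rw [map_add, map_add, hx, hy, mul_add, map_add]
    | tmul x y =>
      rw [Algebra.TensorProduct.tmul_mul_tmul, one_mul]
      rfl
  have hinj : Function.Injective ((f.restrictScalars k).rTensor (B ⧸ J)) :=
    Module.Flat.rTensor_preserves_injective_linearMap _ hf
  exact hinj (by rw [hcomm, hz, map_zero])

/-- Colon ideals by elements of `B` commute with the extension to `A ⊗ B`. -/
theorem mem_extendSum_of_one_tmul_mul_mem (I : Ideal A) {J J' : Ideal B} {b : B}
    (h : ∀ x, b * x ∈ J ↔ x ∈ J') {z : A ⊗[k] B} (hz : 1 ⊗ₜ b * z ∈ extendSum k I J) :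
    z ∈ extendSum k I J' := by
  rw [extendSum_eq_ker, RingHom.mem_ker] at hz ⊢
  let f : B ⧸ J' →ₗ[B] B ⧸ J := Submodule.mapQ J' J (LinearMap.mulLeft B b) fun x hx => (h x).2 hx
  have hf : Function.Injective f := by
    rw [injective_iff_map_eq_zero]
    intro x hx
    obtain ⟨x, rfl⟩ := Ideal.Quotient.mk_surjective x
    exact Ideal.Quotient.eq_zero_iff_mem.2 ((h x).1 (Ideal.Quotient.eq_zero_iff_mem.1 hx))
  have hcomm (z : A ⊗[k] B) : (f.restrictScalars k).lTensor (A ⧸ I)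
      (Algebra.TensorProduct.map (Ideal.Quotient.mkₐ k I) (Ideal.Quotient.mkₐ k J') z) =
      Algebra.TensorProduct.map (Ideal.Quotient.mkₐ k I) (Ideal.Quotient.mkₐ k J)
        (1 ⊗ₜ b * z) := by
    induction z with
    | zero => simp
    | add x y hx hy => rw [map_add, map_add, hx, hy, mul_add, map_add]
    | tmul x y =>
      rw [Algebra.TensorProduct.tmul_mul_tmul, one_mul]
      rfl
  have hinj : Function.Injective ((f.restrictScalars k).lTensor (A ⧸ I)) :=
    Module.Flat.lTensor_preserves_injective_linearMap _ hf
  exact hinj (by rw [hcomm, hz, map_zero])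

theorem tmul_mul_mem_extendSum {I I' : Ideal A} {J J' : Ideal B} {a : A} {b : B}
    (hI : ∀ x ∈ I', a * x ∈ I) (hJ : ∀ y ∈ J', b * y ∈ J) {z : A ⊗[k] B}
    (hz : z ∈ extendSum k I' J') : a ⊗ₜ b * z ∈ extendSum k I J := by
  have hle : extendSum k I' J' ≤ (extendSum k I J).colon {a ⊗ₜ[k] b} := by
    refine sup_le (Ideal.map_le_iff_le_comap.2 fun x hx => ?_)
      (Ideal.map_le_iff_le_comap.2 fun y hy => ?_)
    · rw [Ideal.mem_comap, Submodule.mem_colon_singleton]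
      have : (a * x) ⊗ₜ[k] (1 : B) ∈ extendSum k I J :=
        Ideal.mem_sup_left (tmul_one_mem_extendLeft k (hI x hx))
      simpa [mul_comm] using Ideal.mul_mem_left _ (1 ⊗ₜ b) this
    · rw [Ideal.mem_comap, Submodule.mem_colon_singleton]
      have : (1 : A) ⊗ₜ[k] (b * y) ∈ extendSum k I J :=
        Ideal.mem_sup_right (one_tmul_mem_extendRight k (hJ y hy))
      simpa [mul_comm] using Ideal.mul_mem_left _ (a ⊗ₜ 1) this
  simpa [Submodule.mem_colon_singleton, mul_comm] using hle hz

theorem RegularMod.tmul {I : Ideal A} {J : Ideal B} {s : A} {u : B} (hs : RegularMod I s)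
    (hu : RegularMod J u) : RegularMod (extendSum k I J) (s ⊗ₜ[k] u) := fun z hz => by
  have h1 : s ⊗ₜ[k] u * z = s ⊗ₜ 1 * (1 ⊗ₜ u * z) := by
    rw [← mul_assoc, Algebra.TensorProduct.tmul_mul_tmul, mul_one, one_mul]
  rw [h1] at hz
  exact mem_extendSum_of_one_tmul_mul_mem k I (fun x => ⟨hu x, Ideal.mul_mem_left _ _⟩)
    (mem_extendSum_of_tmul_one_mul_mem k J (fun x => ⟨hs x, Ideal.mul_mem_left _ _⟩) hz)

theorem extendSum_isPrime [IsAlgClosed k] [Algebra.FiniteType k A] (p : Ideal A) [p.IsPrime]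
    (q : Ideal B) [q.IsPrime] : (extendSum k p q).IsPrime := by
  have := isDomain_tensorProduct k (A ⧸ p) (B ⧸ q)
  rw [extendSum_eq_ker]
  exact RingHom.ker_isPrime _

theorem exists_mul_mem_iff_of_mem_associatedPrimes {I p : Ideal A}
    (hp : p ∈ associatedPrimes A (A ⧸ I)) [IsNoetherianRing A] : ∃ x, ∀ y, x * y ∈ I ↔ y ∈ p := by
  rw [AssociatedPrimes.mem_iff, isAssociatedPrime_iff] at hp
  obtain ⟨-, x, rfl⟩ := hp
  obtain ⟨x, rfl⟩ := Ideal.Quotient.mk_surjective x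
  refine ⟨x, fun y => ?_⟩
  rw [Submodule.mem_colon_singleton, Submodule.mem_bot, Algebra.smul_def,
    Ideal.Quotient.algebraMap_eq, ← map_mul, Ideal.Quotient.eq_zero_iff_mem, mul_comm]

/-- Write `p = I : x` and `q = J : y`. If `w` were in `pR + qR`, it would kill `x ⊗ y` modulo `I +
J`, so `x ⊗ y` would lie in `I + J`; taking colons gives `1 ∈ pR + qR`. -/
theorem RegularMod.notMem_extendSum_associatedPrimes [IsAlgClosed k] [Algebra.FiniteType k A]
    [IsNoetherianRing A] [IsNoetherianRing B] {I p : Ideal A} {J q : Ideal B} {w : A ⊗[k] B}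
    (hw : RegularMod (extendSum k I J) w)
    (hp : p ∈ associatedPrimes A (A ⧸ I)) (hq : q ∈ associatedPrimes B (B ⧸ J)) :
    w ∉ extendSum k p q := by
  obtain ⟨x, hx⟩ := exists_mul_mem_iff_of_mem_associatedPrimes hp
  obtain ⟨y, hy⟩ := exists_mul_mem_iff_of_mem_associatedPrimes hq
  have := hp.isPrime
  have := hq.isPrime
  intro hwpq
  have h1 : x ⊗ₜ[k] y ∈ extendSum k I J :=
    hw _ (mul_comm w _ ▸ tmul_mul_mem_extendSum k (fun a => (hx a).2) (fun b => (hy b).2) hwpq)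
  have h2 : x ⊗ₜ[k] y = x ⊗ₜ 1 * (1 ⊗ₜ y * 1) := by simp
  rw [h2] at h1
  have h3 := mem_extendSum_of_one_tmul_mul_mem k p hy (mem_extendSum_of_tmul_one_mul_mem k J hx h1)
  exact (extendSum_isPrime k p q).ne_top ((Ideal.eq_top_iff_one _).2 h3)

end Extension

/-! ### Replacing denominators by pure tensors. -/

section TorsionTransfer

variable {R : Type*} [CommRing R]

/-- Every element killed by `w` modulo `K` is killed by an element of `T` modulo `K`. -/
def TorsionTransfer (w : R) (T : Submonoid R) (K : Ideal R) : Prop :=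
  ∀ z, w * z ∈ K → ∃ t ∈ T, t * z ∈ K

/-- Dévissage along `0 → R/(K : α) → R/K → R/(K + (α)) → 0`; the two denominators multiply. -/
theorem TorsionTransfer.of_colon_of_sup {w : R} {T : Submonoid R} {K K' : Ideal R} {α : R}
    (hle : ∀ z, z ∈ K' ↔ α * z ∈ K) (h1 : TorsionTransfer w T K')
    (h2 : TorsionTransfer w T (Ideal.span {α} ⊔ K)) : TorsionTransfer w T K := fun z hz => by
  obtain ⟨t, ht, htz⟩ := h2 z (Ideal.mem_sup_right hz)
  obtain ⟨_, hy, c, hc, hyc⟩ := Submodule.mem_sup.1 htz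
  obtain ⟨y, rfl⟩ := Ideal.mem_span_singleton'.1 hy
  have hwy : w * y ∈ K' := by
    rw [hle]
    have e : α * (w * y) = t * (w * z) - w * c := by linear_combination w * hyc
    rw [e]
    exact sub_mem (Ideal.mul_mem_left _ _ hz) (Ideal.mul_mem_left _ _ hc)
  obtain ⟨t', ht', hty⟩ := h1 y hwy
  refine ⟨t' * t, T.mul_mem ht' ht, ?_⟩
  rw [hle] at hty
  have e : t' * t * z = α * (t' * y) + t' * c := by linear_combination -t' * hyc
  rw [e]
  exact add_mem hty (Ideal.mul_mem_left _ _ hc)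

/-- Noetherian induction through colon ideals, with prime ideals as the base. -/
theorem induction_colon_sup {A : Type*} [CommRing A] [IsNoetherianRing A] {P : Ideal A → Prop}
    (top : P ⊤) (prime : ∀ p : Ideal A, p.IsPrime → P p)
    (step : ∀ (a : Ideal A) (x : A), P (a.colon {x}) → P (Ideal.span {x} ⊔ a) → P a)
    (a : Ideal A) : P a := by
  induction a using WellFoundedGT.induction with
  | ind a ih =>
    by_cases htop : a = ⊤
    · exact htop ▸ top
    by_cases hp : a.IsPrime
    · exact prime a hp
    obtain ⟨x, hx, y, hy, hxy⟩ : ∃ x, x ∉ a ∧ ∃ y, y ∉ a ∧ x * y ∈ a := by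
      by_contra! hcon
      refine hp ⟨htop, fun {x y} hxy => ?_⟩
      by_contra! h
      exact hcon x h.1 y h.2 hxy
    refine step a x (ih _ (lt_of_le_of_ne (fun z hz => ?_) fun h => hy ?_))
      (ih _ (lt_of_le_of_ne le_sup_right fun h => hx ?_))
    · rw [Submodule.mem_colon_singleton]
      exact Ideal.mul_mem_right _ _ hz
    · rw [h, Submodule.mem_colon_singleton, smul_eq_mul, mul_comm]
      exact hxy
    · rw [h]
      exact Ideal.mem_sup_left (Ideal.mem_span_singleton_self x)

end TorsionTransfer

section Extension

variable (k : Type*) {A B : Type*} [Field k] [CommRing A] [CommRing B] [Algebra k A] [Algebra k B]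

/-- The pure tensors of nonzerodivisors modulo `I` and modulo `J`. -/
def regularTensors (I : Ideal A) (J : Ideal B) : Submonoid (A ⊗[k] B) where
  carrier := {t | ∃ s u, RegularMod I s ∧ RegularMod J u ∧ t = s ⊗ₜ[k] u}
  one_mem' := ⟨1, 1, .one I, .one J, rfl⟩
  mul_mem' := by
    rintro _ _ ⟨s, u, hs, hu, rfl⟩ ⟨s', u', hs', hu', rfl⟩
    exact ⟨_, _, hs.mul hs', hu.mul hu', Algebra.TensorProduct.tmul_mul_tmul _ _ _ _⟩

/-- Dévissage in each factor reduces to primes `p`, `q`. If `p` or `q` contains a regular element,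
it already kills the quotient. Otherwise both lie in associated primes, so `w` avoids the prime `pR
+ qR` and can be cancelled. -/
theorem torsionTransfer_extendSum [IsAlgClosed k] [Algebra.FiniteType k A]
    [IsNoetherianRing A] [IsNoetherianRing B] {I : Ideal A} {J : Ideal B} {w : A ⊗[k] B}
    (hw : RegularMod (extendSum k I J) w) (a : Ideal A) (b : Ideal B) :
    TorsionTransfer w (regularTensors k I J) (extendSum k a b) := by
  have htop (K : Ideal (A ⊗[k] B)) (hK : K = ⊤) :
      TorsionTransfer w (regularTensors k I J) K := fun z _ =>
    ⟨1, Submonoid.one_mem _, hK ▸ Submodule.mem_top⟩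
  induction a using induction_colon_sup with
  | top => exact htop _ (by simp [extendLeft, Ideal.map_top])
  | step a x h1 h2 =>
    refine TorsionTransfer.of_colon_of_sup (K' := extendSum k (a.colon {x}) b)
      (α := x ⊗ₜ 1) (fun z => ⟨fun hz => ?_, fun hz => ?_⟩) h1 ?_
    · refine tmul_mul_mem_extendSum k (fun y hy => ?_) (fun y hy => by rwa [one_mul]) hz
      rwa [Submodule.mem_colon_singleton, smul_eq_mul, mul_comm] at hy
    · exact mem_extendSum_of_tmul_one_mul_mem k b
        (fun y => by rw [Submodule.mem_colon_singleton, smul_eq_mul, mul_comm]) hz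
    · simpa [extendSum, extendLeft, Ideal.map_sup, Ideal.map_span, sup_assoc] using h2
  | prime p hp =>
    induction b using induction_colon_sup with
    | top => exact htop _ (by simp [extendRight, Ideal.map_top])
    | step b x h1 h2 =>
      refine TorsionTransfer.of_colon_of_sup (K' := extendSum k p (b.colon {x}))
        (α := 1 ⊗ₜ x) (fun z => ⟨fun hz => ?_, fun hz => ?_⟩) h1 ?_
      · refine tmul_mul_mem_extendSum k (fun y hy => by rwa [one_mul]) (fun y hy => ?_) hz
        rwa [Submodule.mem_colon_singleton, smul_eq_mul, mul_comm] at hy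
      · exact mem_extendSum_of_one_tmul_mul_mem k p
          (fun y => by rw [Submodule.mem_colon_singleton, smul_eq_mul, mul_comm]) hz
      · simpa [extendSum, extendRight, Ideal.map_sup, Ideal.map_span, sup_left_comm] using h2
    | prime q hq =>
      by_cases hs : ∃ s ∈ p, RegularMod I s
      · obtain ⟨s, hsp, hs⟩ := hs
        exact fun z _ => ⟨s ⊗ₜ 1, ⟨s, 1, hs, .one J, rfl⟩, Ideal.mul_mem_right _ _
          (Ideal.mem_sup_left (tmul_one_mem_extendLeft k hsp))⟩
      by_cases hu : ∃ u ∈ q, RegularMod J u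
      · obtain ⟨u, huq, hu⟩ := hu
        exact fun z _ => ⟨1 ⊗ₜ u, ⟨1, u, .one I, hu, rfl⟩, Ideal.mul_mem_right _ _
          (Ideal.mem_sup_right (one_tmul_mem_extendRight k huq))⟩
      push Not at hs hu
      obtain ⟨p', hp', hpp'⟩ := exists_le_associatedPrime hs
      obtain ⟨q', hq', hqq'⟩ := exists_le_associatedPrime hu
      intro z hz
      refine ⟨1, Submonoid.one_mem _, ?_⟩
      rw [one_mul]
      exact ((extendSum_isPrime k p q).mem_or_mem hz).resolve_left fun h =>
        hw.notMem_extendSum_associatedPrimes k hp' hq' (extendSum_mono k hpp' hqq' h)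

theorem mem_extendSum_symbolicPower [IsAlgClosed k] [Algebra.FiniteType k A]
    [IsNoetherianRing A] [IsNoetherianRing B] {I : Ideal A} {J : Ideal B} {w f : A ⊗[k] B}
    (hw : RegularMod (extendSum k I J) w) {i j : ℕ} (h : w * f ∈ extendSum k (I ^ i) (J ^ j)) :
    f ∈ extendSum k (symbolicPower I i) (symbolicPower J j) := by
  obtain ⟨_, ⟨s, u, hs, hu, rfl⟩, ht⟩ := torsionTransfer_extendSum k hw _ _ _ h
  exact (hs.symbolicPower i).tmul k (hu.symbolicPower j) _
    (extendSum_mono k (pow_le_symbolicPower I i) (pow_le_symbolicPower J j) ht)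

end Extension
instance finiteType_tensorProduct (k A B : Type*) [Field k] [CommRing A] [CommRing B] [Algebra k A]
    [Algebra k B] [Algebra.FiniteType k A] [Algebra.FiniteType k B] :
    Algebra.FiniteType k (A ⊗[k] B) :=
  Algebra.FiniteType.trans (S := A) ‹_› inferInstance

/-! ### Binomial containment for symbolic powers of the sum. -/

section Binomial

variable (k : Type*) {A B : Type*} [Field k] [CommRing A] [CommRing B] [Algebra k A] [Algebra k B]

/-- A `k`-linear projection `π` of `A` onto `V`, tensored with `B`, fixes `z` and the part from
`V'`, and sends `A ⊗ W` into `V ⊗ W`. -/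
theorem mem_extendLeft_sup_mul {V V' : Ideal A} (hV : V' ≤ V) (W : Ideal B) {z : A ⊗[k] B}
    (hz : z ∈ extendLeft k B V) (hz' : z ∈ extendSum k V' W) :
    z ∈ extendLeft k B V' ⊔ extendLeft k B V * extendRight k A W := by
  obtain ⟨g, hg⟩ := (V.restrictScalars k).subtype.exists_leftInverse_of_injective
    (Submodule.ker_subtype _)
  let π : A →ₗ[k] A := (V.restrictScalars k).subtype ∘ₗ g
  have hπ (x : A) : π x ∈ V := (g x).2
  have hfix (U : Ideal A) (hU : U ≤ V) (x : A ⊗[k] B) (hx : x ∈ extendLeft k B U) :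
      π.rTensor B x = x := by
    have hx : x ∈ (extendLeft k B U).restrictScalars k := hx
    rw [extendLeft, Ideal.map_includeLeft_eq] at hx
    obtain ⟨y, rfl⟩ := hx
    rw [← LinearMap.comp_apply, ← LinearMap.rTensor_comp]
    congr 2
    ext u
    exact congrArg Subtype.val (LinearMap.congr_fun hg ⟨u, hU u.2⟩)
  have hW (x : A ⊗[k] B) (hx : x ∈ extendRight k A W) :
      π.rTensor B x ∈ extendLeft k B V * extendRight k A W := by
    have hx' : x ∈ (extendRight k A W).restrictScalars k := hx
    clear hx
    rw [extendRight, Ideal.map_includeRight_eq] at hx'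
    obtain ⟨y, rfl⟩ := hx'
    induction y with
    | zero => simp
    | add x y ihx ihy =>
      rw [map_add, map_add]
      exact add_mem ihx ihy
    | tmul a w =>
      have := Ideal.mul_mem_mul (tmul_one_mem_extendLeft k (B := B) (hπ a))
        (one_tmul_mem_extendRight k (A := A) w.2)
      rwa [Algebra.TensorProduct.tmul_mul_tmul, mul_one, one_mul] at this
  obtain ⟨x, hx, y, hy, rfl⟩ := Submodule.mem_sup.1 hz'
  rw [← hfix V le_rfl _ hz, map_add, hfix V' hV x hx]
  exact Submodule.add_mem_sup hx (hW y hy)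

/-- If `f` lies in `V_(m+1) R + W_(n-m) R` for all `m ≤ n`, then it lies in `∑ V_i R W_(n-i) R`. -/
theorem mem_of_forall_mem_extendSum {V : ℕ → Ideal A} {W : ℕ → Ideal B} (hV : Antitone V)
    (hW : Antitone W) (hV0 : V 0 = ⊤) (hW0 : W 0 = ⊤) {n : ℕ} {P : Ideal (A ⊗[k] B)}
    (hP : ∀ i ≤ n, extendLeft k B (V i) * extendRight k A (W (n - i)) ≤ P) {f : A ⊗[k] B}
    (hf : ∀ m ≤ n, f ∈ extendSum k (V (m + 1)) (W (n - m))) : f ∈ P := by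
  -- Each round moves a piece of `f` from the remainder `z` into `P` and deepens `z` from `V m` to
  -- `V (m + 1)`. Keeping `y` in the extension of `W (n + 1 - m)` lets the hypothesis on `f` pass to
  -- `z = f - y`.
  have key : ∀ m ≤ n, ∃ y z, y + z = f ∧ y ∈ P ∧ y ∈ extendRight k A (W (n + 1 - m)) ∧
      z ∈ extendLeft k B (V m) := by
    intro m
    induction m with
    | zero =>
      intro _
      refine ⟨0, f, zero_add f, zero_mem _, zero_mem _, ?_⟩
      rw [hV0, extendLeft, Ideal.map_top]
      trivial
    | succ m ih =>
      intro hm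
      obtain ⟨y, z, rfl, hyP, hyW, hz⟩ := ih (by omega)
      have hyW' : y ∈ extendRight k A (W (n - m)) := extendRight_mono k (hW (by omega)) hyW
      have hz' : z ∈ extendSum k (V (m + 1)) (W (n - m)) := by
        have := sub_mem (hf m (by omega)) (Ideal.mem_sup_right hyW')
        rwa [add_sub_cancel_left] at this
      obtain ⟨z₁, hz₁, z₂, hz₂, rfl⟩ := Submodule.mem_sup.1
        (mem_extendLeft_sup_mul k (hV m.le_succ) _ hz hz')
      have hz₂' : z₂ ∈ extendRight k A (W (n - m)) :=
        (Ideal.mul_le_right : extendLeft k B (V m) * extendRight k A (W (n - m)) ≤ _) hz₂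
      refine ⟨y + z₂, z₁, by rw [add_assoc, add_comm z₂], add_mem hyP (hP m (by omega) hz₂), ?_, hz₁⟩
      rw [Nat.add_sub_add_right]
      exact add_mem hyW' hz₂'
  obtain ⟨y, z, rfl, hy, -, hz⟩ := key n le_rfl
  refine add_mem hy (hP n le_rfl ?_)
  rwa [Nat.sub_self, hW0, extendRight, Ideal.map_top, Ideal.mul_top]

variable [IsAlgClosed k] [Algebra.FiniteType k A] [Algebra.FiniteType k B]

/-- One half of the binomial expansion of the symbolic powers of `I + J`. -/
theorem symbolicPower_extendSum_le (I : Ideal A) (J : Ideal B) {n : ℕ} {P : Ideal (A ⊗[k] B)}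
    (hP : ∀ i ≤ n, extendLeft k B (symbolicPower I i) *
      extendRight k A (symbolicPower J (n - i)) ≤ P) :
    symbolicPower (extendSum k I J) (n + 1) ≤ P := by
  have : IsNoetherianRing A := Algebra.FiniteType.isNoetherianRing k A
  have : IsNoetherianRing B := Algebra.FiniteType.isNoetherianRing k B
  have : IsNoetherianRing (A ⊗[k] B) := Algebra.FiniteType.isNoetherianRing k _
  intro f hf
  obtain ⟨w, hw, hwf⟩ := mem_symbolicPower_iff.1 hf
  refine mem_of_forall_mem_extendSum k (symbolicPower_antitone I) (symbolicPower_antitone J)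
    (symbolicPower_zero I) (symbolicPower_zero J) hP fun m hm => ?_
  refine mem_extendSum_symbolicPower k hw ?_
  rw [extendSum, extendLeft_pow, extendRight_pow]
  -- The exponents `m + 1` and `n - m` add up to `n + 1`, one more than pigeonhole needs;
  -- `icResurgence_extendSum_le` absorbs the loss.
  refine Ideal.sup_pow_add_le_pow_sup_pow ?_
  rwa [show m + 1 + (n - m) = n + 1 by omega]

theorem symbolicPower_extendLeft (I : Ideal A) (m : ℕ) :
    symbolicPower (extendLeft k B I) m = extendLeft k B (symbolicPower I m) := by
  have : IsNoetherianRing A := Algebra.FiniteType.isNoetherianRing k A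
  have : IsNoetherianRing B := Algebra.FiniteType.isNoetherianRing k B
  have : IsNoetherianRing (A ⊗[k] B) := Algebra.FiniteType.isNoetherianRing k _
  have hE (I : Ideal A) : extendSum k I (⊥ : Ideal B) = extendLeft k B I := by
    simp [extendSum, extendRight, Ideal.map_bot]
  have hbot : symbolicPower (⊥ : Ideal B) 1 = ⊥ := by
    refine le_bot_iff.1 fun x hx => ?_
    obtain ⟨s, hs, h⟩ := mem_symbolicPower_iff.1 hx
    exact hs x (by simpa using h)
  apply le_antisymm
  · intro f hf
    obtain ⟨w, hw, hwf⟩ := mem_symbolicPower_iff.1 hf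
    -- This is the transfer result for `J = ⊥` with `j = 1`.
    rw [← hE, ← hbot]
    rw [← hE] at hw
    refine mem_extendSum_symbolicPower k hw ?_
    rwa [pow_one, hE, extendLeft_pow]
  · refine Ideal.map_le_iff_le_comap.2 fun x hx => mem_symbolicPower_iff.2 ?_
    obtain ⟨s, hs, h⟩ := mem_symbolicPower_iff.1 hx
    refine ⟨s ⊗ₜ 1, hE I ▸ hs.tmul k (.one ⊥), ?_⟩
    rw [← extendLeft_pow]
    simpa using tmul_one_mem_extendLeft k (B := B) h

theorem symbolicPower_extendRight (J : Ideal B) (m : ℕ) :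
    symbolicPower (extendRight k A J) m = extendRight k A (symbolicPower J m) := by
  have : IsNoetherianRing A := Algebra.FiniteType.isNoetherianRing k A
  have : IsNoetherianRing B := Algebra.FiniteType.isNoetherianRing k B
  have : IsNoetherianRing (A ⊗[k] B) := Algebra.FiniteType.isNoetherianRing k _
  have hE (J : Ideal B) : extendSum k (⊥ : Ideal A) J = extendRight k A J := by
    simp [extendSum, extendLeft, Ideal.map_bot]
  have hbot : symbolicPower (⊥ : Ideal A) 1 = ⊥ := by
    refine le_bot_iff.1 fun x hx => ?_
    obtain ⟨s, hs, h⟩ := mem_symbolicPower_iff.1 hx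
    exact hs x (by simpa using h)
  apply le_antisymm
  · intro f hf
    obtain ⟨w, hw, hwf⟩ := mem_symbolicPower_iff.1 hf
    rw [← hE, ← hbot]
    rw [← hE] at hw
    refine mem_extendSum_symbolicPower k hw ?_
    rwa [pow_one, hE, extendRight_pow]
  · refine Ideal.map_le_iff_le_comap.2 fun x hx => mem_symbolicPower_iff.2 ?_
    obtain ⟨s, hs, h⟩ := mem_symbolicPower_iff.1 hx
    refine ⟨1 ⊗ₜ s, hE J ▸ (RegularMod.one ⊥).tmul k hs, ?_⟩
    rw [← extendRight_pow]
    simpa using one_tmul_mem_extendRight k (A := A) h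

end Binomial

/-! ### Retractions onto the factors, and lower bounds. -/

section Retraction

variable (k : Type*) {A B : Type*} [Field k] [IsAlgClosed k] [CommRing A] [CommRing B]
  [Algebra k A] [Algebra k B]

/-- A `k`-point of `B ⧸ J`, which exists by the Nullstellensatz, specializes the second factor. -/
theorem exists_retraction_left [Algebra.FiniteType k B] {J : Ideal B} (hJ : J ≠ ⊤) :
    ∃ ψ : A ⊗[k] B →ₐ[k] A, (∀ a, ψ (a ⊗ₜ 1) = a) ∧ ∀ b ∈ J, ψ (1 ⊗ₜ b) = 0 := by
  have : Nontrivial (B ⧸ J) := Ideal.Quotient.nontrivial_iff.2 hJ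
  obtain ⟨ε⟩ := nonempty_algHom_of_isAlgClosed k (B ⧸ J)
  refine ⟨Algebra.TensorProduct.lift (AlgHom.id k A) ((Algebra.ofId k A).comp
    (ε.comp (Ideal.Quotient.mkₐ k J))) fun _ _ => .all _ _, fun a => by simp, fun b hb => ?_⟩
  simp [Ideal.Quotient.eq_zero_iff_mem.2 hb]

theorem exists_retraction_right [Algebra.FiniteType k A] {I : Ideal A} (hI : I ≠ ⊤) :
    ∃ ψ : A ⊗[k] B →ₐ[k] B, (∀ b, ψ (1 ⊗ₜ b) = b) ∧ ∀ a ∈ I, ψ (a ⊗ₜ 1) = 0 := by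
  obtain ⟨ψ, h1, h2⟩ := exists_retraction_left k (A := B) hI
  exact ⟨ψ.comp (Algebra.TensorProduct.comm k A B), by simpa using h1, by simpa using h2⟩

theorem extendLeft_le_extendLeft_iff [Algebra.FiniteType k B] [Nontrivial B] {V V' : Ideal A} :
    extendLeft k B V ≤ extendLeft k B V' ↔ V ≤ V' := by
  refine ⟨fun h x hx => ?_, extendLeft_mono k⟩
  obtain ⟨ψ, h1, -⟩ := exists_retraction_left k (A := A) (J := (⊥ : Ideal B)) bot_ne_top
  have hle : extendLeft k B V' ≤ V'.comap ψ :=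
    Ideal.map_le_iff_le_comap.2 fun y hy => by simpa [h1] using hy
  simpa [h1] using hle (h (tmul_one_mem_extendLeft k hx))

theorem extendRight_le_extendRight_iff [Algebra.FiniteType k A] [Nontrivial A] {V V' : Ideal B} :
    extendRight k A V ≤ extendRight k A V' ↔ V ≤ V' := by
  refine ⟨fun h x hx => ?_, extendRight_mono k⟩
  obtain ⟨ψ, h1, -⟩ := exists_retraction_right k (B := B) (I := (⊥ : Ideal A)) bot_ne_top
  have hle : extendRight k A V' ≤ V'.comap ψ :=
    Ideal.map_le_iff_le_comap.2 fun y hy => by simpa [h1] using hy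
  simpa [h1] using hle (h (one_tmul_mem_extendRight k hx))

variable [Algebra.FiniteType k A] [Algebra.FiniteType k B]

theorem asymptoticResurgence_extendLeft [Nontrivial B] (I : Ideal A) :
    asymptoticResurgence (extendLeft k B I) = asymptoticResurgence I := by
  simp only [asymptoticResurgence, symbolicPower_extendLeft, ← extendLeft_pow,
    extendLeft_le_extendLeft_iff]

theorem asymptoticResurgence_extendRight [Nontrivial A] (J : Ideal B) :
    asymptoticResurgence (extendRight k A J) = asymptoticResurgence J := by
  simp only [asymptoticResurgence, symbolicPower_extendRight, ← extendRight_pow,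
    extendRight_le_extendRight_iff]

/-- A witness `f` for `I` gives the witness `f ⊗ 1` with the same denominator; an integral equation
for it over `(I+J)^r` would retract to one for `f` over `I^r`. -/
theorem icResurgence_le_extendSum_left (I : Ideal A) {J : Ideal B} (hJ : J ≠ ⊤) :
    icResurgence I ≤ icResurgence (extendSum k I J) := by
  have : IsNoetherianRing A := Algebra.FiniteType.isNoetherianRing k A
  have : IsNoetherianRing (A ⊗[k] B) := Algebra.FiniteType.isNoetherianRing k _
  refine sSup_le_sSup ?_
  rintro _ ⟨m, r, hm, hr, rfl, h⟩
  refine ⟨m, r, hm, hr, rfl, fun hcon => h fun f hf => ?_⟩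
  obtain ⟨ψ, h1, h2⟩ := exists_retraction_left k (A := A) hJ
  have hmap : (extendSum k I J).map ψ ≤ I := by
    refine Ideal.map_le_iff_le_comap.2 (sup_le (Ideal.map_le_iff_le_comap.2 fun x hx => ?_)
      (Ideal.map_le_iff_le_comap.2 fun x hx => ?_))
    · simpa [h1] using hx
    · simp [h2 x hx]
  have hf' : f ⊗ₜ 1 ∈ symbolicPower (extendSum k I J) m := by
    obtain ⟨s, hs, hsf⟩ := mem_symbolicPower_iff.1 hf
    refine mem_symbolicPower_iff.2 ⟨s ⊗ₜ 1, hs.tmul k (.one J), ?_⟩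
    refine Ideal.pow_right_mono le_sup_left m ?_
    rw [← extendLeft_pow]
    simpa using tmul_one_mem_extendLeft k (B := B) hsf
  have := map_mem_integralClosure (ψ : A ⊗[k] B →+* A) (K' := I ^ r)
    (by rw [Ideal.map_pow]; exact Ideal.pow_right_mono hmap r) (hcon hf')
  simpa [h1] using this

theorem icResurgence_le_extendSum_right {I : Ideal A} (hI : I ≠ ⊤) (J : Ideal B) :
    icResurgence J ≤ icResurgence (extendSum k I J) := by
  have : IsNoetherianRing B := Algebra.FiniteType.isNoetherianRing k B
  have : IsNoetherianRing (A ⊗[k] B) := Algebra.FiniteType.isNoetherianRing k _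
  refine sSup_le_sSup ?_
  rintro _ ⟨m, r, hm, hr, rfl, h⟩
  refine ⟨m, r, hm, hr, rfl, fun hcon => h fun f hf => ?_⟩
  obtain ⟨ψ, h1, h2⟩ := exists_retraction_right k (B := B) hI
  have hmap : (extendSum k I J).map ψ ≤ J := by
    refine Ideal.map_le_iff_le_comap.2 (sup_le (Ideal.map_le_iff_le_comap.2 fun x hx => ?_)
      (Ideal.map_le_iff_le_comap.2 fun x hx => ?_))
    · simp [h2 x hx]
    · simpa [h1] using hx
  have hf' : 1 ⊗ₜ f ∈ symbolicPower (extendSum k I J) m := by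
    obtain ⟨s, hs, hsf⟩ := mem_symbolicPower_iff.1 hf
    refine mem_symbolicPower_iff.2 ⟨1 ⊗ₜ s, (RegularMod.one I).tmul k hs, ?_⟩
    refine Ideal.pow_right_mono le_sup_right m ?_
    rw [← extendRight_pow]
    simpa using one_tmul_mem_extendRight k (A := A) hsf
  have := map_mem_integralClosure (ψ : A ⊗[k] B →+* B) (K' := J ^ r)
    (by rw [Ideal.map_pow]; exact Ideal.pow_right_mono hmap r) (hcon hf')
  simpa [h1] using this

end Retraction

/-! ### Upper bound for the sum. -/

section UpperBound

/-- For `j = i * q / p` positive, `i / j ≥ p / q` exceeds the resurgence, so the symbolic power is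
integral over `I^j`, at a cost of `c`. -/
theorem symbolicPower_le_pow_of_icResurgence_lt {A : Type*} [CommRing A] {I : Ideal A} {c p q : ℕ}
    (hc : ∀ n, integralClosure (I ^ n) ⊆ (I ^ (n - c) : Ideal A)) (hq : 1 ≤ q)
    (h : icResurgence I < (p : ℝ≥0∞) / q) (i : ℕ) :
    symbolicPower I i ≤ I ^ (i * q / p - c) := by
  rcases Nat.eq_zero_or_pos (i * q / p) with h0 | h0
  · simp [h0]
  have hle : i * q / p * p ≤ i * q := Nat.div_mul_le_self _ _
  have hi : 1 ≤ i := by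
    by_contra hi
    simp [Nat.lt_one_iff.1 (not_le.1 hi)] at h0
  refine (symbolicPower_subset_of_icResurgence_lt hi h0 (h.trans_le ?_)).trans (hc _)
  rw [← not_lt, natCast_div_lt_natCast_div_iff h0 hq, not_lt, mul_comm]
  exact hle

variable (k : Type*) {A B : Type*} [Field k] [IsAlgClosed k] [CommRing A] [CommRing B]
  [Algebra k A] [Algebra k B] [Algebra.FiniteType k A] [Algebra.FiniteType k B]

theorem icResurgence_extendSum_le {I : Ideal A} {J : Ideal B} {c c' : ℕ}
    (hc : ∀ n, integralClosure (I ^ n) ⊆ (I ^ (n - c) : Ideal A))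
    (hc' : ∀ n, integralClosure (J ^ n) ⊆ (J ^ (n - c') : Ideal B)) :
    icResurgence (extendSum k I J) ≤ max (icResurgence I) (icResurgence J) := by
  have : IsNoetherianRing (A ⊗[k] B) := Algebra.FiniteType.isNoetherianRing k _
  refine sSup_le ?_
  rintro _ ⟨m, r, hm, hr, rfl, h⟩
  by_contra! hlt
  obtain ⟨p, q, hp, hq, h1, h2⟩ := exists_natCast_div_between hlt
  rw [natCast_div_lt_natCast_div_iff hq hr] at h2
  refine h fun f hf => ?_
  -- The gap `p * r < m * q` gains at least `N`. It must cover `q` for `n = m * N - 1`, `2 * p` for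
  -- the two floors, and `p * (c + c')` for the integral closures.
  let N := q + 2 * p + p * (c + c')
  have hN : 1 ≤ N := by simp only [N]; omega
  refine mem_integralClosure_of_pow_mem (n := N) hN ?_
  obtain ⟨n, hn⟩ : ∃ n, m * N = n + 1 := Nat.exists_eq_succ_of_ne_zero (by positivity)
  have hfN := pow_mem_symbolicPower hf N
  rw [hn] at hfN
  refine symbolicPower_extendSum_le k I J (fun i hi => ?_) hfN
  have hI := symbolicPower_le_pow_of_icResurgence_lt hc hq ((le_max_left _ _).trans_lt h1) i
  have hJ := symbolicPower_le_pow_of_icResurgence_lt hc' hq ((le_max_right _ _).trans_lt h1)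
    (n - i)
  refine (Ideal.mul_mono (extendLeft_mono k hI) (extendRight_mono k hJ)).trans ?_
  rw [extendLeft_pow, extendRight_pow]
  refine (Ideal.mul_mono (Ideal.pow_right_mono (le_sup_left : _ ≤ extendSum k I J) _)
    (Ideal.pow_right_mono (le_sup_right : _ ≤ extendSum k I J) _)).trans ?_
  rw [← pow_add]
  refine Ideal.pow_le_pow_right ?_
  have ha := Nat.lt_mul_div_succ (i * q) hp
  have hb := Nat.lt_mul_div_succ ((n - i) * q) hp
  have hin : i * q + (n - i) * q = n * q := by rw [← add_mul]; congr 1; omega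
  have hle : p * (r * N + c + c') ≤ p * (i * q / p + (n - i) * q / p) := by
    have h3 : (p * r + 1) * N ≤ m * q * N := Nat.mul_le_mul_right _ h2
    have h4 : m * q * N = n * q + q := by rw [mul_right_comm, hn]; ring
    have h5 : N = q + 2 * p + p * (c + c') := rfl
    nlinarith
  have := Nat.le_of_mul_le_mul_left hle hp
  omega

end UpperBound
end Resurgence

/-! ### Assembly of the equalities. -/

theorem mainTheorem4 {k A B : Type*} [Field k] [IsAlgClosed k]
    [CommRing A] [IsDomain A] [Algebra k A] [Algebra.FiniteType k A]
    [CommRing B] [IsDomain B] [Algebra k B] [Algebra.FiniteType k B]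
    (𝒜 : ℕ → Submodule k A) [GradedAlgebra 𝒜] (ℬ : ℕ → Submodule k B) [GradedAlgebra ℬ]
    (I : Ideal A) (hI : I.IsHomogeneous 𝒜) (hI_ne_bot : I ≠ ⊥) (hI_ne_top : I ≠ ⊤)
    (J : Ideal B) (hJ : J.IsHomogeneous ℬ) (hJ_ne_bot : J ≠ ⊥) (hJ_ne_top : J ≠ ⊤)
    (IR JR : Ideal (A ⊗[k] B))
    (hIR : IR = Resurgence.extendLeft k B I) (hJR : JR = Resurgence.extendRight k A J) :
    Resurgence.asymptoticResurgence (IR ⊔ JR) = Resurgence.icAsymptoticResurgence (IR ⊔ JR) ∧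
    Resurgence.icAsymptoticResurgence (IR ⊔ JR) = Resurgence.icResurgence (IR ⊔ JR) ∧
    Resurgence.icResurgence (IR ⊔ JR) =
      max (Resurgence.asymptoticResurgence I) (Resurgence.asymptoticResurgence J) ∧
    max (Resurgence.asymptoticResurgence I) (Resurgence.asymptoticResurgence J) =
      max (Resurgence.asymptoticResurgence IR) (Resurgence.asymptoticResurgence JR) := by
  open Resurgence in
  subst hIR hJR
  have : IsNoetherianRing A := Algebra.FiniteType.isNoetherianRing k A
  have : IsNoetherianRing B := Algebra.FiniteType.isNoetherianRing k B
  have : IsNoetherianRing (A ⊗[k] B) := Algebra.FiniteType.isNoetherianRing k _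
  have : IsDomain (A ⊗[k] B) := isDomain_tensorProduct k A B
  have hne : extendSum k I J ≠ ⊥ := fun h => hI_ne_bot <| by
    rw [← le_bot_iff, ← extendLeft_le_extendLeft_iff k (B := B)]
    exact le_sup_left.trans (h.le.trans bot_le)
  obtain ⟨c, hc⟩ := exists_integralClosure_pow_subset k hI_ne_bot
  obtain ⟨c', hc'⟩ := exists_integralClosure_pow_subset k hJ_ne_bot
  obtain ⟨d, hd⟩ := exists_integralClosure_pow_subset k hne
  -- The inequalities `h1`, `h2`, `h3` form a cycle, so all three invariants of `I + J` agree; the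
  -- same cycle is used for `I` and `J`.
  have h1 := asymptoticResurgence_le_icAsymptoticResurgence hd
  have h2 := icAsymptoticResurgence_le_icResurgence (extendSum k I J)
  have h3 := icResurgence_le_asymptoticResurgence (extendSum k I J)
  have hicI : icResurgence I = asymptoticResurgence I :=
    (icResurgence_le_asymptoticResurgence I).antisymm
      ((asymptoticResurgence_le_icAsymptoticResurgence hc).trans
        (icAsymptoticResurgence_le_icResurgence I))
  have hicJ : icResurgence J = asymptoticResurgence J :=
    (icResurgence_le_asymptoticResurgence J).antisymm
      ((asymptoticResurgence_le_icAsymptoticResurgence hc').trans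
        (icAsymptoticResurgence_le_icResurgence J))
  refine ⟨h1.antisymm (h2.trans h3), h2.antisymm (h3.trans h1), ?_, ?_⟩
  · rw [← hicI, ← hicJ]
    exact (icResurgence_extendSum_le k hc hc').antisymm (max_le
      (icResurgence_le_extendSum_left k I hJ_ne_top) (icResurgence_le_extendSum_right k hI_ne_top J))
  · rw [asymptoticResurgence_extendLeft, asymptoticResurgence_extendRight]
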